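/- Let $A$ and $B$ be quantum systems with nonzero finite-dimensional Hilbert spaces, and let $\mathbb{L}(A)$, $\mathbb{L}(B)$ be the linear operators on them. A linear map $\Lambda:\mathbb{L}(A)\to\mathbb{L}(B)$ is CP if $\mathrm{id}_A\otimes\Lambda$ maps positive semidefinite operators to positive semidefinite operators; it is CPTP if moreover $\operatorname{Tr}\Lambda(X)=\operatorname{Tr}X$ for all $X$, and CPTNI if it is CP and $\operatorname{Tr}\Lambda(X)\le\operatorname{Tr}X$ for all $X\ge 0$. The Choi operator of a map $\Phi$ is $J_\Phi=(\mathrm{id}_A\otimes\Phi)[|\Omega\rangle\langle\Omega|]$ with $|\Omega\rangle=\sum_i|ii\rangle$. For a Hermiticity-preserving linear map $\Phi:\mathbb{L}(A)\to\mathbb{L}(B)$ put $$\|\Phi\|_\diamond=\max\{\|(\mathrm{id}_A\otimes\Phi)(\rho)\|_1 : \rho\in\mathbb{L}(A\otimes A),\ \rho\ge0,\ \operatorname{Tr}\rho=1\},$$ where $\|\cdot\|_1$ is the trace norm, $$\|\Phi\|_{\mathrm{bnorm}}=\min\{\lambda_++\lambda_- : \Phi=\lambda_+\Lambda_+-\lambda_-\Lambda_-,\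 \Lambda_\pm\in\mathrm{CPTNI},\ \lambda_\pm\ge0\},$$ $$R(\Phi)=\min\Big\{\lambda\ge0 : \tfrac{\Phi+\lambda\Lambda}{1+\lambda}\in\mathrm{CPTNI},\ \Lambda\in\mathrm{CPTNI}\Big\},$$ $$R'(\Phi)=\min\{\lambda\ge0 : J_\Phi\le(1+\lambda)J_\Lambda,\ \Lambda\in\mathrm{CPTNI}\},$$ $$R''(\Phi)=\min\{\lambda\ge0 : \Phi+\lambda\Lambda\in\mathrm{CP},\ \Lambda\in\mathrm{CPTNI}\}.$$ **Theorem.** Let $\Phi:\mathbb{L}(A)\to\mathbb{L}(B)$ be a Hermiticity-preserving linear map. (i) If $\operatorname{Tr}_BJ_\Phi=t\,\mathbb{1}_A$ for some scalar $t$ (in particular, if $\Phi$ is trace preserving), then $$\|\Phi\|_\diamond=\|\Phi\|_{\mathrm{bnorm}}=\min\{\mu_++\mu_- : J_\Phi=\mu_+J_{\Lambda_+}-\mu_-J_{\Lambda_-},\ \Lambda_\pm\in\mathrm{CPTP},\ \mu_\pm\ge0\},$$ where the maximum and the minima involved are attained. (ii) If $\Phi$ is trace preserving, then the minima defining $R(\Phi)$,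 $R'(\Phi)$, $R''(\Phi)$ are attained and $$R(\Phi)=R'(\Phi)=R''(\Phi)=\frac{\|\Phi\|_{\mathrm{bnorm}}-1}{2}=\frac{\|\Phi\|_\diamond-1}{2}.$$ -/

import Mathlib

open scoped Kronecker ComplexOrder

noncomputable section

namespace QuantumMap

/-- Linear maps `𝕃(A) → 𝕃(B)`; the Hilbert spaces of `A` and `B` are `ℂ^a` and `ℂ^b`. -/
abbrev Map (a b : Type*) : Type _ := Matrix a a ℂ →ₗ[ℂ] Matrix b b ℂ

section General

variable {k a b : Type*}

/-- The map `id ⊗ Φ`, which applies `Φ` to every block of a block matrix. -/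
def idTensor (k : Type*) {a b : Type*} (Φ : Map a b) : Map (k × a) (k × b) where
  toFun M := Matrix.of fun x y =>
    Φ (Matrix.of fun p q => M (x.1, p) (y.1, q)) x.2 y.2
  map_add' M N := by
    ext x y
    exact congrFun (congrFun (Φ.map_add (Matrix.of fun p q => M (x.1, p) (y.1, q))
      (Matrix.of fun p q => N (x.1, p) (y.1, q))) x.2) y.2
  map_smul' c M := by
    ext x y
    exact congrFun (congrFun (Φ.map_smul c (Matrix.of fun p q => M (x.1, p) (y.1, q))) x.2) y.2

/-- On product operators, `idTensor` acts as `id ⊗ Φ`. -/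
theorem idTensor_kronecker (Φ : Map a b) (X : Matrix k k ℂ) (Y : Matrix a a ℂ) :
    idTensor k Φ (X ⊗ₖ Y) = X ⊗ₖ Φ Y := by
  ext x y
  exact congrFun (congrFun (Φ.map_smul (X x.1 y.1) Y) x.2) y.2

/-- The partial trace over the second tensor factor. -/
def traceB [Fintype b] (M : Matrix (a × b) (a × b) ℂ) : Matrix a a ℂ :=
  Matrix.of fun i j => ∑ p, M (i, p) (j, p)

/-- The trace norm (Schatten 1-norm): the sum of the singular values of `X`. -/
def traceNorm [Fintype a] [DecidableEq a] (X : Matrix a a ℂ) : ℝ :=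
  ∑ i, √((Matrix.isHermitian_conjTranspose_mul_self X).eigenvalues i)

/-- Density operators. -/
def IsState [Fintype a] (ρ : Matrix a a ℂ) : Prop :=
  ρ.PosSemidef ∧ ρ.trace = 1

/-- The unnormalised maximally entangled vector `∑ᵢ |ii⟩`. -/
def omega (a : Type*) [DecidableEq a] : a × a → ℂ :=
  fun x => if x.1 = x.2 then 1 else 0

/-- The Choi operator `J_Φ = (id_A ⊗ Φ)[|Ω⟩⟨Ω|]`. -/
def choi [DecidableEq a] (Φ : Map a b) : Matrix (a × b) (a × b) ℂ :=
  idTensor a Φ (Matrix.vecMulVec (omega a) (star (omega a)))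

/-- `Φ` maps Hermitian operators to Hermitian operators. -/
def HermitianPreserving (Φ : Map a b) : Prop :=
  ∀ X : Matrix a a ℂ, X.IsHermitian → (Φ X).IsHermitian

/-- `Φ` maps positive semidefinite operators to positive semidefinite operators. -/
def Positive (Φ : Map a b) : Prop :=
  ∀ X : Matrix a a ℂ, X.PosSemidef → (Φ X).PosSemidef

/-- Complete positivity: `id_A ⊗ Φ` is positive. -/
def CP (Φ : Map a b) : Prop :=
  Positive (idTensor a Φ)

/-- `Φ` preserves the trace. -/
def TracePreserving [Fintype a] [Fintype b] (Φ : Map a b) : Prop :=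
  ∀ X : Matrix a a ℂ, (Φ X).trace = X.trace

/-- `Φ` does not increase the trace of positive semidefinite operators (for the maps considered
here both traces are real). -/
def TraceNonincreasing [Fintype a] [Fintype b] (Φ : Map a b) : Prop :=
  ∀ X : Matrix a a ℂ, X.PosSemidef → (Φ X).trace.re ≤ X.trace.re

/-- Quantum channels. -/
def CPTP [Fintype a] [Fintype b] (Φ : Map a b) : Prop :=
  CP Φ ∧ TracePreserving Φ

/-- Probabilistic quantum operations (quantum subchannels). -/
def CPTNI [Fintype a] [Fintype b] (Φ : Map a b) : Prop :=
  CP Φ ∧ TraceNonincreasing Φ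

end General

section Measures

variable {a b : Type*} [Fintype a] [DecidableEq a] [Fintype b] [DecidableEq b]

/-- The values over which the diamond norm is the maximum. -/
def diamondSet (Φ : Map a b) : Set ℝ :=
  {x | ∃ ρ : Matrix (a × a) (a × a) ℂ, IsState ρ ∧ x = traceNorm (idTensor a Φ ρ)}

/-- The diamond norm. -/
def diamondNorm (Φ : Map a b) : ℝ := sSup (diamondSet Φ)

/-- The values over which the CPTNI base norm is the minimum. -/
def baseNormSet (Φ : Map a b) : Set ℝ :=
  {x | ∃ (lp lm : ℝ) (Λp Λm : Map a b), 0 ≤ lp ∧ 0 ≤ lm ∧ CPTNI Λp ∧ CPTNI Λm ∧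
    Φ = lp • Λp - lm • Λm ∧ x = lp + lm}

/-- The base norm with respect to the CPTNI maps. -/
def baseNorm (Φ : Map a b) : ℝ := sInf (baseNormSet Φ)

/-- The values `μ₊ + μ₋` over all decompositions `J_Φ = μ₊ J_{Λ₊} - μ₋ J_{Λ₋}` with channels
`Λ±` and `μ± ≥ 0`. -/
def channelDecompSet (Φ : Map a b) : Set ℝ :=
  {x | ∃ (mp mm : ℝ) (Λp Λm : Map a b), 0 ≤ mp ∧ 0 ≤ mm ∧ CPTP Λp ∧ CPTP Λm ∧
    choi Φ = mp • choi Λp - mm • choi Λm ∧ x = mp + mm}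

/-- Feasible values for the robustness `R`. -/
def robustnessSet (Φ : Map a b) : Set ℝ :=
  {l | 0 ≤ l ∧ ∃ Λ : Map a b, CPTNI Λ ∧ CPTNI ((1 + l)⁻¹ • (Φ + l • Λ))}

/-- The robustness `R`. -/
def robustness (Φ : Map a b) : ℝ := sInf (robustnessSet Φ)

/-- Feasible values for the robustness `R'`: `J_Φ ≤ (1 + l) J_Λ` in the Loewner order. -/
def robustnessSet' (Φ : Map a b) : Set ℝ :=
  {l | 0 ≤ l ∧ ∃ Λ : Map a b, CPTNI Λ ∧ ((1 + l) • choi Λ - choi Φ).PosSemidef}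

/-- The robustness `R'`. -/
def robustness' (Φ : Map a b) : ℝ := sInf (robustnessSet' Φ)

/-- Feasible values for the robustness `R''`. -/
def robustnessSet'' (Φ : Map a b) : Set ℝ :=
  {l | 0 ≤ l ∧ ∃ Λ : Map a b, CPTNI Λ ∧ CP (Φ + l • Λ)}

/-- The robustness `R''`. -/
def robustness'' (Φ : Map a b) : ℝ := sInf (robustnessSet'' Φ)

end Measures

end QuantumMap

end

/-! Weak duality: if `Φ = λ₊Λ₊ - λ₋Λ₋` with subchannels, then `id ⊗ Φ` sends a state to a difference
of positive operators of traces at most `λ₊` and `λ₋`, so every decomposition costs at least the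
diamond norm `D`.

Strong duality: for Hermitian `X`, `‖X‖₁` is the maximum of `2 Tr(PX) - Tr X` over `0 ≤ P ≤ 1`.
Evaluated on the pure states `(T ⊗ 1)|Ω⟩` with `σ = T*T`, this turns the bound by `D` into `Tr(QJ) ≤
(D+t)/2 · Tr σ` whenever `0 ≤ Q ≤ σ ⊗ 1` (`re_trace_mul_choi_le`). Separation from a closed cone
(`exists_posSemidef_dominating`) then yields `M ≥ 0` with `M ≥ J` and `Tr_B M ≤ (D+t)/2 · 1`.
Padding `M` makes the last relation an equality. Since `Tr_B J = t·1`, `M - J` has partial trace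
`(D-t)/2 · 1`, so `M` and `M - J` are multiples of Choi operators of channels and `J = M - (M - J)`
costs exactly `D`.

In the trace-preserving case `t = 1`, and the same two channels make `(D-1)/2` feasible for all
three robustnesses. Conversely, a feasible `l` writes `Φ` as a difference of CP maps whose output
traces on a state sum to at most `1 + 2l`. -/

namespace QuantumMap

/-! ### The positive semidefinite cone: self-duality, closedness, compact slices. -/

section PositiveSemidefinite

variable {n m : Type*} [Fintype n] [Fintype m]

open scoped MatrixOrder in
theorem exists_eq_conjTranspose_mul_self {P : Matrix n n ℂ} (hP : P.PosSemidef) :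
    ∃ B : Matrix n n ℂ, P = B.conjTranspose * B := by
  classical
  obtain ⟨B, hB⟩ := CStarAlgebra.nonneg_iff_eq_star_mul_self.mp hP.nonneg
  exact ⟨B, hB⟩

theorem trace_mul_nonneg {P Q : Matrix n n ℂ} (hP : P.PosSemidef) (hQ : Q.PosSemidef) :
    0 ≤ (P * Q).trace := by
  obtain ⟨B, rfl⟩ := exists_eq_conjTranspose_mul_self hP
  rw [Matrix.trace_mul_cycle, Matrix.trace_mul_cycle]
  exact (hQ.mul_mul_conjTranspose_same B).trace_nonneg

theorem re_trace_mul_nonneg {P Q : Matrix n n ℂ} (hP : P.PosSemidef) (hQ : Q.PosSemidef) :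
    0 ≤ (P * Q).trace.re :=
  (Complex.le_def.mp (trace_mul_nonneg hP hQ)).1

theorem trace_mul_vecMulVec (Q : Matrix n n ℂ) (v : n → ℂ) :
    (Q * Matrix.vecMulVec v (star v)).trace = star v ⬝ᵥ Q.mulVec v := by
  rw [Matrix.mul_vecMulVec, Matrix.trace_vecMulVec, dotProduct_comm]

/-- The positive semidefinite cone is self-dual. -/
theorem posSemidef_of_re_trace_mul_nonneg {Q : Matrix n n ℂ} (hQ : Q.IsHermitian)
    (h : ∀ X : Matrix n n ℂ, X.PosSemidef → 0 ≤ (Q * X).trace.re) : Q.PosSemidef := by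
  refine Matrix.PosSemidef.of_dotProduct_mulVec_nonneg hQ fun v => ?_
  have h1 := h _ (Matrix.posSemidef_vecMulVec_self_star v)
  rw [trace_mul_vecMulVec] at h1
  rw [Complex.le_def]
  refine ⟨h1, ?_⟩
  have := hQ.im_star_dotProduct_mulVec_self v
  simpa using this.symm

theorem isClosed_posSemidef : IsClosed {M : Matrix n n ℂ | M.PosSemidef} := by
  have : {M : Matrix n n ℂ | M.PosSemidef} =
      {M | M.conjTranspose = M} ∩ ⋂ x : n → ℂ, {M | 0 ≤ star x ⬝ᵥ M.mulVec x} := by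
    ext M
    simp only [Set.mem_ofPred_eq, Set.mem_inter_iff, Set.mem_iInter]
    exact Matrix.posSemidef_iff_dotProduct_mulVec
  rw [this]
  refine (isClosed_eq (by fun_prop) (by fun_prop)).inter (isClosed_iInter fun x => ?_)
  exact isClosed_le continuous_const (by fun_prop)

/-- With `M = B*B`, entries are inner products of columns of `B` and the trace is the sum of their
squared norms; AM-GM does the rest. This gives the boundedness behind all compactness arguments. -/
theorem norm_apply_le_re_trace {M : Matrix n n ℂ} (hM : M.PosSemidef) (i j : n) :
    ‖M i j‖ ≤ M.trace.re := by
  obtain ⟨B, rfl⟩ := exists_eq_conjTranspose_mul_self hM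
  have htr : (B.conjTranspose * B).trace.re = ∑ i, ∑ k, ‖B k i‖ ^ 2 := by
    simp only [Matrix.trace, Matrix.diag, Matrix.mul_apply, Matrix.conjTranspose_apply,
      Complex.re_sum]
    refine Finset.sum_congr rfl fun i _ => Finset.sum_congr rfl fun k _ => ?_
    rw [Complex.star_def, Complex.conj_mul']
    norm_cast
  have hle (l : n) : ∑ k, ‖B k l‖ ^ 2 ≤ ∑ i, ∑ k, ‖B k i‖ ^ 2 :=
    Finset.single_le_sum (f := fun i => ∑ k, ‖B k i‖ ^ 2)
      (fun i _ => Finset.sum_nonneg fun k _ => sq_nonneg _) (Finset.mem_univ l)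
  have hij : ‖(B.conjTranspose * B) i j‖ ≤ ∑ k, (‖B k i‖ ^ 2 + ‖B k j‖ ^ 2) / 2 := by
    rw [Matrix.mul_apply]
    refine (norm_sum_le _ _).trans (Finset.sum_le_sum fun k _ => ?_)
    rw [norm_mul, Matrix.conjTranspose_apply, norm_star]
    nlinarith [sq_nonneg (‖B k i‖ - ‖B k j‖)]
  rw [htr]
  rw [← Finset.sum_div, Finset.sum_add_distrib] at hij
  linarith [hle i, hle j]

theorem isCompact_posSemidef_trace_le (c : ℝ) :
    IsCompact {M : Matrix n n ℂ | M.PosSemidef ∧ M.trace.re ≤ c} := by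
  have hbox : IsCompact {M : Matrix n n ℂ | ∀ i j, M i j ∈ Metric.closedBall (0 : ℂ) c} := by
    have := isCompact_univ_pi (X := fun _ : n => n → ℂ) fun i =>
      isCompact_univ_pi (X := fun _ : n => ℂ) fun j => isCompact_closedBall (0 : ℂ) c
    have heq : {M : Matrix n n ℂ | ∀ i j, M i j ∈ Metric.closedBall (0 : ℂ) c} =
        Set.univ.pi fun _ => Set.univ.pi fun _ => Metric.closedBall (0 : ℂ) c :=
      Set.ext fun M => ⟨fun h i _ j _ => h i j, fun h i j => h i trivial j trivial⟩
    rw [heq]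
    exact this
  refine hbox.of_isClosed_subset
    (isClosed_posSemidef.inter (isClosed_le
      (Complex.continuous_re.comp (continuous_id.matrix_trace)) continuous_const)) fun M hM i j => ?_
  rw [mem_closedBall_zero_iff]
  exact (norm_apply_le_re_trace hM.1 i j).trans hM.2

omit [Fintype n] in
theorem posSemidef_real_smul {M : Matrix n n ℂ} (hM : M.PosSemidef) {r : ℝ} (hr : 0 ≤ r) :
    (r • M).PosSemidef :=
  Matrix.PosSemidef.smul hM hr

end PositiveSemidefinite

/-! ### Variational formula for the trace norm of a Hermitian matrix. -/

section TraceNorm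

variable {n : Type*} [Fintype n] [DecidableEq n] {X : Matrix n n ℂ}

open Polynomial in
theorem traceNorm_eq_sum_abs_eigenvalues (hX : X.IsHermitian) :
    traceNorm X = ∑ i, |hX.eigenvalues i| := by
  set Y := X.conjTranspose * X
  have hY : Y.IsHermitian := Matrix.isHermitian_conjTranspose_mul_self X
  have hpoly : Y.charpoly = ∏ i, (Polynomial.X - C (((hX.eigenvalues i) ^ 2 : ℝ) : ℂ)) := by
    have h1 : Y = Unitary.conjStarAlgAut ℂ _ hX.eigenvectorUnitary
        (Matrix.diagonal fun i => (((hX.eigenvalues i) ^ 2 : ℝ) : ℂ)) := by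
      have h2 : Y = X * X := by rw [show Y = X.conjTranspose * X from rfl, hX.eq]
      rw [h2]
      conv_lhs => rw [hX.spectral_theorem]
      rw [← map_mul, Matrix.diagonal_mul_diagonal]
      congr 2
      ext i
      simp [sq]
    conv_lhs => rw [h1, Unitary.conjStarAlgAut_apply, Matrix.charpoly_mul_comm, ← mul_assoc]
    simp [Matrix.charpoly_diagonal]
  -- The two eigenvalue families may be ordered differently, so they are compared as multisets of
  -- roots of one characteristic polynomial.
  have hroots : Multiset.map (fun i => ((hY.eigenvalues i : ℝ) : ℂ)) Finset.univ.val =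
      Multiset.map (fun i => (((hX.eigenvalues i) ^ 2 : ℝ) : ℂ)) Finset.univ.val := by
    have h1 := hY.roots_charpoly_eq_eigenvalues
    rw [hpoly, Polynomial.roots_prod _ _
      (Finset.prod_ne_zero_iff.mpr fun i _ => Polynomial.X_sub_C_ne_zero _)] at h1
    simp only [Polynomial.roots_X_sub_C, Multiset.bind_singleton] at h1
    exact h1.symm
  have h3 := congrArg (fun s : Multiset ℂ => (s.map fun z => √z.re).sum) hroots
  simp only [Multiset.map_map, Function.comp_def, Complex.ofReal_re, Real.sqrt_sq_eq_abs] at h3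
  exact h3

/-- The trace of `W X` in an eigenbasis of `X`. -/
theorem re_trace_mul_eq_sum_eigenvalues (hX : X.IsHermitian) (W : Matrix n n ℂ) :
    (W * X).trace.re = ∑ i, hX.eigenvalues i *
      ((star (hX.eigenvectorUnitary : Matrix n n ℂ) * W * hX.eigenvectorUnitary) i i).re := by
  conv_lhs => rw [hX.spectral_theorem, Unitary.conjStarAlgAut_apply]
  rw [← Matrix.mul_assoc, ← Matrix.mul_assoc, Matrix.trace_mul_comm, ← Matrix.mul_assoc,
    ← Matrix.mul_assoc, Matrix.trace, Complex.re_sum]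
  refine Finset.sum_congr rfl fun i _ => ?_
  rw [Matrix.diag_apply, Matrix.mul_diagonal]
  simp [mul_comm]

theorem conj_eigenvectorUnitary_posSemidef (hX : X.IsHermitian) {W : Matrix n n ℂ}
    (hW : W.PosSemidef) :
    (star (hX.eigenvectorUnitary : Matrix n n ℂ) * W * hX.eigenvectorUnitary).PosSemidef :=
  hW.conjTranspose_mul_mul_same _

omit [Fintype n] [DecidableEq n] in
theorem re_nonneg_diag {W : Matrix n n ℂ} (hW : W.PosSemidef) (i : n) : 0 ≤ (W i i).re :=
  (Complex.le_def.mp hW.diag_nonneg).1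

/-- In an eigenbasis of `X` the diagonal entries `pᵢ` of `P` lie in `[0, 1]`, so `(2pᵢ - 1)λᵢ ≤
|λᵢ|`. -/
theorem two_mul_re_trace_sub_le_traceNorm (hX : X.IsHermitian) {P : Matrix n n ℂ}
    (hP : P.PosSemidef) (hP1 : (1 - P).PosSemidef) :
    2 * (P * X).trace.re - X.trace.re ≤ traceNorm X := by
  have h1 := re_trace_mul_eq_sum_eigenvalues hX P
  have h2 := re_trace_mul_eq_sum_eigenvalues hX 1
  have hU : star (hX.eigenvectorUnitary : Matrix n n ℂ) * hX.eigenvectorUnitary = 1 :=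
    Unitary.coe_star_mul_self _
  rw [Matrix.one_mul] at h2
  rw [h1, h2, traceNorm_eq_sum_abs_eigenvalues hX, Finset.mul_sum, ← Finset.sum_sub_distrib]
  refine Finset.sum_le_sum fun i _ => ?_
  have h3 := re_nonneg_diag (conj_eigenvectorUnitary_posSemidef hX hP) i
  have h4 := re_nonneg_diag (conj_eigenvectorUnitary_posSemidef hX hP1) i
  rw [Matrix.mul_sub, Matrix.sub_mul, Matrix.sub_apply, Complex.sub_re] at h4
  simp only [Matrix.mul_one, hU, Matrix.one_apply_eq, Complex.one_re] at h4 ⊢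
  cases abs_cases (hX.eigenvalues i) <;> nlinarith

/-- The optimal effect is the spectral projection of `X` onto its nonnegative eigenvalues. -/
theorem exists_two_mul_re_trace_sub_eq_traceNorm (hX : X.IsHermitian) :
    ∃ P : Matrix n n ℂ, P.PosSemidef ∧ (1 - P).PosSemidef ∧
      2 * (P * X).trace.re - X.trace.re = traceNorm X := by
  classical
  set U : Matrix n n ℂ := (hX.eigenvectorUnitary : Matrix n n ℂ)
  have hU : star U * U = 1 := Unitary.coe_star_mul_self _
  have hU' : U * star U = 1 := Unitary.coe_mul_star_self _
  set d : n → ℂ := fun i => if 0 ≤ hX.eigenvalues i then 1 else 0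
  have hd : (Matrix.diagonal d).PosSemidef := by
    refine Matrix.PosSemidef.diagonal fun i => ?_
    simp only [d, Pi.zero_apply]; split_ifs <;> simp
  have hd1 : (1 - Matrix.diagonal d).PosSemidef := by
    rw [← Matrix.diagonal_one, Matrix.diagonal_sub]
    refine Matrix.PosSemidef.diagonal fun i => ?_
    simp only [d, Pi.zero_apply]; split_ifs <;> simp
  refine ⟨U * Matrix.diagonal d * star U, hd.mul_mul_conjTranspose_same U, ?_, ?_⟩
  · have := hd1.mul_mul_conjTranspose_same U
    rwa [Matrix.mul_sub, Matrix.sub_mul, Matrix.mul_one, ← Matrix.star_eq_conjTranspose, hU'] at this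
  · have h1 := re_trace_mul_eq_sum_eigenvalues hX (U * Matrix.diagonal d * star U)
    have h2 := re_trace_mul_eq_sum_eigenvalues hX 1
    have h5 : star U * (U * Matrix.diagonal d * star U) * U = Matrix.diagonal d := by
      rw [Matrix.mul_assoc, Matrix.mul_assoc, hU, Matrix.mul_one, ← Matrix.mul_assoc, hU,
        Matrix.one_mul]
    rw [Matrix.one_mul] at h2
    rw [h1, h2, traceNorm_eq_sum_abs_eigenvalues hX, Finset.mul_sum, ← Finset.sum_sub_distrib]
    refine Finset.sum_congr rfl fun i _ => ?_
    change 2 * (hX.eigenvalues i * ((star U * (U * Matrix.diagonal d * star U) * U) i i).re) -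
      hX.eigenvalues i * ((star U * (1 : Matrix n n ℂ) * U) i i).re = _
    rw [h5, Matrix.mul_one, hU]
    simp only [Matrix.one_apply_eq, Matrix.diagonal_apply_eq, Complex.one_re, d]
    split_ifs with h
    · rw [abs_of_nonneg h]; simp; ring
    · rw [abs_of_neg (not_le.mp h)]; simp

theorem traceNorm_sub_le {M N : Matrix n n ℂ} (hM : M.PosSemidef) (hN : N.PosSemidef) :
    traceNorm (M - N) ≤ M.trace.re + N.trace.re := by
  obtain ⟨P, hP, hP1, h⟩ := exists_two_mul_re_trace_sub_eq_traceNorm (hM.1.sub hN.1)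
  have h1 := re_trace_mul_nonneg hP hN
  have h2 := re_trace_mul_nonneg hP1 hM
  rw [Matrix.sub_mul, Matrix.one_mul] at h2
  rw [← h, Matrix.mul_sub]
  simp only [Matrix.trace_sub, Complex.sub_re] at h2 ⊢
  linarith

end TraceNorm

end QuantumMap

noncomputable section

namespace QuantumMap

/-! ### The Choi correspondence. -/

section ChoiCorrespondence

variable {k a b : Type*}

theorem idTensor_add (Φ Ψ : Map a b) (M : Matrix (k × a) (k × a) ℂ) :
    idTensor k (Φ + Ψ) M = idTensor k Φ M + idTensor k Ψ M := rfl

theorem idTensor_sub (Φ Ψ : Map a b) (M : Matrix (k × a) (k × a) ℂ) :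
    idTensor k (Φ - Ψ) M = idTensor k Φ M - idTensor k Ψ M := rfl

theorem idTensor_smul (r : ℝ) (Φ : Map a b) (M : Matrix (k × a) (k × a) ℂ) :
    idTensor k (r • Φ) M = r • idTensor k Φ M := rfl

theorem CP.real_smul {Φ : Map a b} (h : CP Φ) {r : ℝ} (hr : 0 ≤ r) : CP (r • Φ) :=
  fun X hX => posSemidef_real_smul (h X hX) hr

variable [DecidableEq a]

theorem choi_add (Φ Ψ : Map a b) : choi (Φ + Ψ) = choi Φ + choi Ψ := rfl

theorem choi_sub (Φ Ψ : Map a b) : choi (Φ - Ψ) = choi Φ - choi Ψ := rfl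

theorem choi_smul (r : ℝ) (Φ : Map a b) : choi (r • Φ) = r • choi Φ := rfl

theorem choi_apply (Φ : Map a b) (x y : a × b) :
    choi Φ x y = Φ (Matrix.single x.1 y.1 1) x.2 y.2 := by
  have h : (Matrix.of fun p q => Matrix.vecMulVec (omega a) (star (omega a)) (x.1, p) (y.1, q)) =
      Matrix.single x.1 y.1 1 := by
    ext p q
    simp only [Matrix.of_apply, Matrix.vecMulVec_apply, omega, Pi.star_apply, Matrix.single_apply,
      ite_and, apply_ite (star : ℂ → ℂ), star_one, star_zero, ite_mul, one_mul, zero_mul]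
  change Φ _ x.2 y.2 = _
  rw [h]

variable [Fintype a]

theorem apply_eq_sum_choi (Φ : Map a b) (X : Matrix a a ℂ) (p q : b) :
    Φ X p q = ∑ i, ∑ j, X i j * choi Φ (i, p) (j, q) := by
  conv_lhs => rw [Matrix.matrix_eq_sum_single X]
  simp only [map_sum, Matrix.sum_apply, choi_apply]
  refine Finset.sum_congr rfl fun i _ => Finset.sum_congr rfl fun j _ => ?_
  rw [show Matrix.single i j (X i j) = X i j • Matrix.single i j (1 : ℂ) by simp, map_smul]
  rfl

theorem choi_injective {Φ Ψ : Map a b} (h : choi Φ = choi Ψ) : Φ = Ψ := by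
  refine LinearMap.ext fun X => Matrix.ext fun p q => ?_
  rw [apply_eq_sum_choi, apply_eq_sum_choi, h]

theorem idTensor_apply_eq_sum (Φ : Map a b) (M : Matrix (k × a) (k × a) ℂ) (x y : k × b) :
    idTensor k Φ M x y = ∑ i, ∑ j, M (x.1, i) (y.1, j) * choi Φ (i, x.2) (j, y.2) := by
  change Φ _ x.2 y.2 = _
  rw [apply_eq_sum_choi]
  rfl

omit [DecidableEq a] in
/-- The map with a given Choi operator. -/
def ofChoi (M : Matrix (a × b) (a × b) ℂ) : Map a b where
  toFun X := Matrix.of fun p q => ∑ i, ∑ j, X i j * M (i, p) (j, q)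
  map_add' X Y := by
    ext p q
    simp [add_mul, Finset.sum_add_distrib]
  map_smul' c X := by
    ext p q
    simp [Finset.mul_sum, mul_assoc]

theorem choi_ofChoi (M : Matrix (a × b) (a × b) ℂ) : choi (ofChoi M) = M := by
  ext x y
  rw [choi_apply]
  change ∑ i, ∑ j, Matrix.single x.1 y.1 (1 : ℂ) i j * M (i, x.2) (j, y.2) = _
  simp [Matrix.single_apply, ite_and]

omit [Fintype a] in
theorem isHermitian_choi {Φ : Map a b} (hΦ : HermitianPreserving Φ) :
    (choi Φ).IsHermitian := by
  -- Preserving Hermiticity of `X + X*` and of `i(X - X*)` forces `Φ` to commute with the adjoint.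
  have key (X : Matrix a a ℂ) : Φ X.conjTranspose = (Φ X).conjTranspose := by
    have h1 : (X + X.conjTranspose).IsHermitian := Matrix.isHermitian_add_transpose_self X
    have h2 : (Complex.I • (X - X.conjTranspose)).IsHermitian := by
      rw [Matrix.IsHermitian, Matrix.conjTranspose_smul, Matrix.conjTranspose_sub,
        Matrix.conjTranspose_conjTranspose, Complex.star_def, Complex.conj_I, neg_smul,
        ← smul_neg, neg_sub]
    have h3 := (hΦ _ h1).eq
    have h4 := (hΦ _ h2).eq
    simp only [map_smul, map_add, map_sub, Matrix.conjTranspose_smul, Matrix.conjTranspose_add,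
      Matrix.conjTranspose_sub, Complex.star_def, Complex.conj_I] at h3 h4
    rw [neg_smul, ← smul_neg, neg_sub] at h4
    have h5 := smul_right_injective _ Complex.I_ne_zero h4
    have h6 : (2 : ℂ) • Φ X.conjTranspose = (2 : ℂ) • (Φ X).conjTranspose := by
      ext p q
      have h3' := congrFun (congrFun h3 p) q
      have h5' := congrFun (congrFun h5 p) q
      simp only [Matrix.add_apply, Matrix.sub_apply, Matrix.smul_apply, smul_eq_mul] at h3' h5' ⊢
      linear_combination h5' - h3'
    exact smul_right_injective _ (two_ne_zero) h6
  ext x y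
  rw [Matrix.conjTranspose_apply, choi_apply, choi_apply,
    show Matrix.single x.1 y.1 (1 : ℂ) = (Matrix.single y.1 x.1 1).conjTranspose by simp, key]
  rfl

theorem isHermitian_idTensor {Φ : Map a b} (hΦ : (choi Φ).IsHermitian)
    {M : Matrix (k × a) (k × a) ℂ} (hM : M.IsHermitian) : (idTensor k Φ M).IsHermitian := by
  ext x y
  rw [Matrix.conjTranspose_apply, idTensor_apply_eq_sum, idTensor_apply_eq_sum, star_sum,
    Finset.sum_comm]
  refine Finset.sum_congr rfl fun i _ => ?_
  rw [star_sum]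
  refine Finset.sum_congr rfl fun j _ => ?_
  rw [star_mul', hM.apply, hΦ.apply]

/-- Choi's theorem. -/
theorem cp_iff_posSemidef_choi [Fintype b] (Φ : Map a b) : CP Φ ↔ (choi Φ).PosSemidef := by
  classical
  refine ⟨fun h => h _ (Matrix.posSemidef_vecMulVec_self_star _), fun h ρ hρ => ?_⟩
  -- Compression by `V` contracts the second factor of `ρ` with the input factor of the Choi
  -- operator, so `(id ⊗ Φ)(ρ)` is a congruence of `ρ ⊗ J_Φ`.
  let V : Matrix ((a × a) × (a × b)) (a × b) ℂ := Matrix.of fun x y =>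
    if x.1.1 = y.1 ∧ x.1.2 = x.2.1 ∧ x.2.2 = y.2 then 1 else 0
  have hV : idTensor a Φ ρ = V.conjTranspose * (ρ ⊗ₖ choi Φ) * V := by
    ext x y
    rw [idTensor_apply_eq_sum, Matrix.mul_apply]
    simp only [Matrix.mul_apply, Matrix.conjTranspose_apply, V, Matrix.of_apply,
      Fintype.sum_prod_type, Matrix.kroneckerMap_apply, ite_and, apply_ite (star : ℂ → ℂ),
      star_one, star_zero, ite_mul, mul_ite, one_mul, zero_mul, mul_one, mul_zero]
    simp only [Finset.sum_ite_eq, Finset.sum_ite_eq', Finset.sum_ite_irrel,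
      Finset.sum_const_zero, Finset.mem_univ, if_true]
    rw [Finset.sum_comm]
  rw [hV]
  exact (hρ.kronecker h).conjTranspose_mul_mul_same V

end ChoiCorrespondence

/-! ### Partial traces and trace conditions. -/

section PartialTrace

variable {k a b : Type*} [Fintype b]

theorem traceB_zero : traceB (0 : Matrix (a × b) (a × b) ℂ) = 0 := by
  ext i j
  simp [traceB]

theorem traceB_add (M N : Matrix (a × b) (a × b) ℂ) : traceB (M + N) = traceB M + traceB N := by
  ext i j
  simp [traceB, Finset.sum_add_distrib]

theorem traceB_sub (M N : Matrix (a × b) (a × b) ℂ) : traceB (M - N) = traceB M - traceB N := by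
  ext i j
  simp [traceB, Finset.sum_sub_distrib]

theorem traceB_smul (r : ℝ) (M : Matrix (a × b) (a × b) ℂ) :
    traceB (r • M) = r • traceB M := by
  ext i j
  simp [traceB, Finset.mul_sum]

theorem traceB_kronecker (X : Matrix a a ℂ) (Y : Matrix b b ℂ) :
    traceB (X ⊗ₖ Y) = Y.trace • X := by
  ext i j
  simp [traceB, Matrix.trace, Finset.mul_sum, mul_comm]

theorem continuous_traceB :
    Continuous (traceB : Matrix (a × b) (a × b) ℂ → Matrix a a ℂ) := by
  refine continuous_matrix fun i j => ?_
  change Continuous fun M : Matrix (a × b) (a × b) ℂ => ∑ p, M (i, p) (j, p)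
  fun_prop

theorem posSemidef_traceB {M : Matrix (a × b) (a × b) ℂ} (hM : M.PosSemidef) :
    (traceB M).PosSemidef := by
  have : traceB M = ∑ p, M.submatrix (fun i => (i, p)) (fun i => (i, p)) := by
    ext i j
    simp [traceB, Matrix.sum_apply]
  rw [this]
  exact Matrix.posSemidef_sum _ fun p _ => hM.submatrix _

variable [Fintype a]

theorem trace_traceB (M : Matrix (a × b) (a × b) ℂ) : (traceB M).trace = M.trace := by
  simp [traceB, Matrix.trace, Fintype.sum_prod_type]

theorem trace_kronecker_one_mul [DecidableEq b] (S : Matrix a a ℂ) (M : Matrix (a × b) (a × b) ℂ) :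
    ((S ⊗ₖ (1 : Matrix b b ℂ)) * M).trace = (S * traceB M).trace := by
  simp only [Matrix.trace, Matrix.diag_apply, Matrix.mul_apply, Fintype.sum_prod_type,
    Matrix.kroneckerMap_apply, traceB, Matrix.of_apply, Matrix.one_apply, mul_ite, mul_one,
    mul_zero, ite_mul, zero_mul, Finset.sum_ite_eq, Finset.mem_univ, if_true, Finset.mul_sum]
  exact Finset.sum_congr rfl fun i _ => Finset.sum_comm

theorem trace_apply_eq [DecidableEq a] (Φ : Map a b) (X : Matrix a a ℂ) :
    (Φ X).trace = ∑ i, ∑ j, X i j * traceB (choi Φ) i j := by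
  simp only [Matrix.trace, Matrix.diag_apply, apply_eq_sum_choi Φ X, traceB, Matrix.of_apply,
    Finset.mul_sum]
  rw [Finset.sum_comm]
  exact Finset.sum_congr rfl fun i _ => Finset.sum_comm

theorem tracePreserving_iff [DecidableEq a] (Φ : Map a b) :
    TracePreserving Φ ↔ traceB (choi Φ) = 1 := by
  constructor
  · intro h
    ext i j
    have h1 := h (Matrix.single i j 1)
    rw [trace_apply_eq] at h1
    simp only [Matrix.single_apply, ite_and, ite_mul, one_mul, zero_mul, Finset.sum_ite_irrel,
      Finset.sum_const_zero, Finset.sum_ite_eq, Finset.mem_univ, if_true] at h1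
    rw [h1, Matrix.one_apply]
    split_ifs with hij
    · subst hij; simp
    · exact Matrix.trace_single_eq_of_ne i j 1 hij
  · intro h X
    rw [trace_apply_eq, h]
    simp [Matrix.one_apply, Matrix.trace]

/-- The partial trace over the first tensor factor. -/
def traceA (M : Matrix (a × b) (a × b) ℂ) : Matrix b b ℂ :=
  ∑ i, M.submatrix (fun p => (i, p)) (fun p => (i, p))

omit [Fintype b] in
theorem posSemidef_traceA {M : Matrix (a × b) (a × b) ℂ} (hM : M.PosSemidef) :
    (traceA M).PosSemidef :=
  Matrix.posSemidef_sum _ fun _ _ => hM.submatrix _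

theorem trace_traceA (M : Matrix (a × b) (a × b) ℂ) : (traceA M).trace = M.trace := by
  simp [traceA, Matrix.trace, Fintype.sum_prod_type, Matrix.sum_apply, Finset.sum_comm (γ := a)]

omit [Fintype a] in
theorem trace_idTensor [Fintype k] (Φ : Map a b) (M : Matrix (k × a) (k × a) ℂ) :
    (idTensor k Φ M).trace = (Φ (traceA M)).trace := by
  rw [traceA, map_sum, Matrix.trace_sum]
  simp only [Matrix.trace, Fintype.sum_prod_type]
  rfl

theorem CPTNI.re_trace_idTensor_le [Fintype k] {Λ : Map a b} (h : CPTNI Λ)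
    {M : Matrix (k × a) (k × a) ℂ} (hM : M.PosSemidef) :
    (idTensor k Λ M).trace.re ≤ M.trace.re := by
  rw [trace_idTensor, ← trace_traceA M]
  exact h.2 _ (posSemidef_traceA hM)

theorem CPTP.cptni {Λ : Map a b} (h : CPTP Λ) : CPTNI Λ :=
  ⟨h.1, fun X _ => by rw [h.2 X]⟩

end PartialTrace

end QuantumMap

end

noncomputable section

namespace QuantumMap

/-! ### Conic duality by separation. -/

section Duality

variable {n a b : Type*} [Fintype n]

/-- Real functionals on Hermitian matrices are represented by Hermitian matrices. -/
theorem exists_isHermitian_re_trace_mul [DecidableEq n] (f : Matrix n n ℂ →ₗ[ℝ] ℝ) :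
    ∃ Q : Matrix n n ℂ, Q.IsHermitian ∧
      ∀ X : Matrix n n ℂ, X.IsHermitian → f X = (Q * X).trace.re := by
  let g : Matrix n n ℂ →ₗ[ℂ] ℂ := Module.Dual.extendRCLike f
  have hg (X) : (g X).re = f X := Module.Dual.re_extendRCLike_apply (𝕜 := ℂ) f X
  let G : Matrix n n ℂ := Matrix.of fun j i => g (Matrix.single i j 1)
  have hG (X : Matrix n n ℂ) : g X = (G * X).trace := by
    conv_lhs => rw [Matrix.matrix_eq_sum_single X]
    simp only [map_sum, Matrix.trace, Matrix.diag_apply, Matrix.mul_apply, G, Matrix.of_apply]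
    rw [Finset.sum_comm]
    refine Finset.sum_congr rfl fun i _ => Finset.sum_congr rfl fun j _ => ?_
    rw [show Matrix.single j i (X j i) = X j i • Matrix.single j i (1 : ℂ) by simp, map_smul,
      smul_eq_mul, mul_comm]
  -- Against Hermitian `X`, the real part of the trace sees only the Hermitian part of `G`.
  refine ⟨(1 / 2 : ℝ) • (G + G.conjTranspose), ?_, fun X hX => ?_⟩
  · rw [Matrix.IsHermitian, Matrix.conjTranspose_smul, star_trivial,
      Matrix.isHermitian_add_transpose_self G]
  · have h1 : (G.conjTranspose * X).trace = star (G * X).trace := by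
      rw [← Matrix.trace_conjTranspose, Matrix.conjTranspose_mul, hX.eq, Matrix.trace_mul_comm]
    rw [Matrix.smul_mul, Matrix.add_mul, Matrix.trace_smul, Matrix.trace_add, h1, ← hG,
      Complex.smul_re, Complex.add_re, Complex.star_def, Complex.conj_re, hg, smul_eq_mul]
    ring

variable [Fintype a] [Fintype b]

/-- The pairs `(X, Y)` for which some `M ≥ 0` has `X ≤ M` and `Tr_B M ≤ Y`. -/
def dominationSet (a b : Type*) [Fintype b] : Set (Matrix (a × b) (a × b) ℂ × Matrix a a ℂ) :=
  {z | ∃ M : Matrix (a × b) (a × b) ℂ, M.PosSemidef ∧ (M - z.1).PosSemidef ∧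
    (z.2 - traceB M).PosSemidef}

/-- A witness satisfies `Tr M ≤ Tr Y`, so near a limit point all witnesses lie in one compact set,
and projecting a closed set along a compact factor is closed. -/
theorem isClosed_dominationSet : IsClosed (dominationSet a b) := by
  refine isClosed_of_closure_subset fun z hz => ?_
  -- The slack `1` makes the trace bound hold on an open neighbourhood of `z`.
  set c : ℝ := z.2.trace.re + 1
  let K : Set (Matrix (a × b) (a × b) ℂ) := {M | M.PosSemidef ∧ M.trace.re ≤ c}
  have : CompactSpace K := isCompact_iff_compactSpace.mp (isCompact_posSemidef_trace_le c)
  let F : Set (K × (Matrix (a × b) (a × b) ℂ × Matrix a a ℂ)) :=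
    {w | (w.1.1 - w.2.1).PosSemidef ∧ (w.2.2 - traceB w.1.1).PosSemidef}
  have hF : IsClosed F := by
    refine IsClosed.inter ?_ ?_
    · exact isClosed_posSemidef.preimage
        (f := fun w : K × (Matrix (a × b) (a × b) ℂ × Matrix a a ℂ) => w.1.1 - w.2.1)
        (by fun_prop)
    · exact isClosed_posSemidef.preimage
        (f := fun w : K × (Matrix (a × b) (a × b) ℂ × Matrix a a ℂ) => w.2.2 - traceB w.1.1)
        ((by fun_prop : Continuous fun w : K × (Matrix (a × b) (a × b) ℂ × Matrix a a ℂ) =>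
          w.2.2).sub (continuous_traceB.comp (by fun_prop)))
  have hSF : IsClosed (Prod.snd '' F) := isClosedMap_snd_of_compactSpace _ hF
  let U : Set (Matrix (a × b) (a × b) ℂ × Matrix a a ℂ) := {w | w.2.trace.re < c}
  have hU : IsOpen U :=
    isOpen_lt (Complex.continuous_re.comp (continuous_snd.matrix_trace)) continuous_const
  have hzU : z ∈ U := lt_add_one z.2.trace.re
  have hsub : U ∩ dominationSet a b ⊆ Prod.snd '' F := by
    rintro w ⟨hwU, M, hM, h1, h2⟩
    have h3 := (Complex.le_def.mp h2.trace_nonneg).1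
    rw [Matrix.trace_sub, trace_traceB, Complex.sub_re, Complex.zero_re] at h3
    have hwU' : w.2.trace.re < c := hwU
    exact ⟨(⟨M, hM, by linarith⟩, w), ⟨h1, h2⟩, rfl⟩
  have hmem := hSF.closure_subset_iff.mpr hsub (hU.inter_closure ⟨hzU, hz⟩)
  obtain ⟨⟨M, w⟩, ⟨h1, h2⟩, hw⟩ := hmem
  rw [← hw]
  exact ⟨M.1, M.2.1, h1, h2⟩

/-- The set `dominationSet` as a proper cone. -/
def dominationCone (a b : Type*) [Fintype a] [Fintype b] :
    ProperCone ℝ (Matrix (a × b) (a × b) ℂ × Matrix a a ℂ) where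
  carrier := dominationSet a b
  add_mem' := by
    rintro z w ⟨M, hM, h1, h2⟩ ⟨N, hN, h3, h4⟩
    refine ⟨M + N, hM.add hN, ?_, ?_⟩
    · rw [Prod.fst_add, add_sub_add_comm]
      exact h1.add h3
    · rw [Prod.snd_add, traceB_add, add_sub_add_comm]
      exact h2.add h4
  zero_mem' := ⟨0, .zero, by simpa using .zero, by simpa [traceB_zero] using .zero⟩
  smul_mem' := by
    rintro ⟨r, hr⟩ z ⟨M, hM, h1, h2⟩
    refine ⟨r • M, posSemidef_real_smul hM hr, ?_, ?_⟩
    · have := posSemidef_real_smul h1 hr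
      rwa [smul_sub] at this
    · have := posSemidef_real_smul h2 hr
      rwa [smul_sub, ← traceB_smul] at this
  isClosed' := isClosed_dominationSet

/-- If no `M` exists, a functional `(X, Y) ↦ Tr(σY) - Tr(QX)` is nonnegative on the cone and
negative at `(J, μ·1)`. Testing it on the cone gives `σ ≥ 0` and `0 ≤ Q ≤ σ ⊗ 1`, contradicting `h`.
-/
theorem exists_posSemidef_dominating [DecidableEq a] [DecidableEq b]
    {J : Matrix (a × b) (a × b) ℂ} (hJ : J.IsHermitian) (μ : ℝ)
    (h : ∀ (σ : Matrix a a ℂ) (Q : Matrix (a × b) (a × b) ℂ), σ.PosDef → Q.PosSemidef →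
      (σ ⊗ₖ (1 : Matrix b b ℂ) - Q).PosSemidef → (Q * J).trace.re ≤ μ * σ.trace.re) :
    ∃ M : Matrix (a × b) (a × b) ℂ, M.PosSemidef ∧ (M - J).PosSemidef ∧
      (μ • (1 : Matrix a a ℂ) - traceB M).PosSemidef := by
  by_contra hcon
  have hnot : (J, μ • (1 : Matrix a a ℂ)) ∉ dominationCone a b := hcon
  have : LocallyConvexSpace ℝ (Matrix (a × b) (a × b) ℂ) :=
    inferInstanceAs (LocallyConvexSpace ℝ (a × b → a × b → ℂ))
  have : LocallyConvexSpace ℝ (Matrix a a ℂ) :=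
    inferInstanceAs (LocallyConvexSpace ℝ (a → a → ℂ))
  obtain ⟨f, hf, hfneg⟩ := (dominationCone a b).hyperplane_separation_point hnot
  obtain ⟨Q, hQ, hfQ⟩ := exists_isHermitian_re_trace_mul
    (-(f.toLinearMap ∘ₗ LinearMap.inl ℝ (Matrix (a × b) (a × b) ℂ) (Matrix a a ℂ)))
  obtain ⟨σ, hσ, hfσ⟩ := exists_isHermitian_re_trace_mul
    (f.toLinearMap ∘ₗ LinearMap.inr ℝ (Matrix (a × b) (a × b) ℂ) (Matrix a a ℂ))
  have hfXY (X : Matrix (a × b) (a × b) ℂ) (Y : Matrix a a ℂ) (hX : X.IsHermitian)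
      (hY : Y.IsHermitian) : f (X, Y) = (σ * Y).trace.re - (Q * X).trace.re := by
    rw [← hfQ X hX, ← hfσ Y hY]
    have : (X, Y) = (X, 0) + (0, Y) := by simp
    rw [this, map_add]
    simp [add_comm]
  have hσpos : σ.PosSemidef := by
    refine posSemidef_of_re_trace_mul_nonneg hσ fun Y hY => ?_
    have h1 := hf (0, Y) ⟨0, .zero, by simpa using .zero, by simpa [traceB_zero] using hY⟩
    rw [hfXY _ _ Matrix.isHermitian_zero hY.1] at h1
    simpa using h1
  have hQpos : Q.PosSemidef := by
    refine posSemidef_of_re_trace_mul_nonneg hQ fun X hX => ?_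
    have h1 := hf (-X, 0) ⟨0, .zero, by simpa using hX, by simpa [traceB_zero] using .zero⟩
    rw [hfXY _ _ hX.1.neg Matrix.isHermitian_zero] at h1
    simpa using h1
  have hone : (σ ⊗ₖ (1 : Matrix b b ℂ)).IsHermitian := by
    rw [Matrix.IsHermitian, Matrix.conjTranspose_kronecker, hσ.eq, Matrix.conjTranspose_one]
  have hdom : (σ ⊗ₖ (1 : Matrix b b ℂ) - Q).PosSemidef := by
    refine posSemidef_of_re_trace_mul_nonneg (hone.sub hQ) fun X hX => ?_
    have h1 := hf (X, traceB X) ⟨X, hX, by simpa using .zero, by simpa using .zero⟩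
    rw [hfXY _ _ hX.1 (posSemidef_traceB hX).1] at h1
    rwa [Matrix.sub_mul, Matrix.trace_sub, trace_kronecker_one_mul, Complex.sub_re]
  rw [hfXY _ _ hJ (by rw [Matrix.IsHermitian, Matrix.conjTranspose_smul]; simp)] at hfneg
  have htr : (σ * μ • (1 : Matrix a a ℂ)).trace.re = μ * σ.trace.re := by simp
  rw [htr] at hfneg
  -- Separation only gives `σ ≥ 0`, while `h` asks for positive definiteness, hence the shift by
  -- `ε·1`; below, `ε` is chosen so that it costs at most half the gap `δ`.
  have hpert (ε : ℝ) (hε : 0 < ε) :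
      (Q * J).trace.re ≤ μ * (σ.trace.re + ε * Fintype.card a) := by
    have hε1 : (ε • (1 : Matrix a a ℂ)).PosDef := Matrix.PosDef.smul Matrix.PosDef.one hε
    have h1 := h (σ + ε • 1) Q (hε1.posSemidef_add hσpos) hQpos (by
      have h2 := hdom.add (posSemidef_real_smul
        (Matrix.PosSemidef.one : (1 : Matrix (a × b) (a × b) ℂ).PosSemidef) hε.le)
      rw [Matrix.add_kronecker, Matrix.smul_kronecker, Matrix.one_kronecker_one]
      convert h2 using 1
      abel)
    simpa using h1
  set δ := (Q * J).trace.re - μ * σ.trace.re with hδ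
  have hδpos : 0 < δ := by linarith
  set c := |μ * Fintype.card a| + 1 with hc
  have hcpos : 0 < c := by positivity
  have h1 := hpert (δ / (2 * c)) (by positivity)
  have h2 : μ * (δ / (2 * c) * Fintype.card a) ≤ δ / (2 * c) * c := by
    have : μ * Fintype.card a ≤ c := (le_abs_self _).trans (by linarith)
    calc μ * (δ / (2 * c) * Fintype.card a) = δ / (2 * c) * (μ * Fintype.card a) := by ring
      _ ≤ _ := by gcongr
  have h3 : δ / (2 * c) * c = δ / 2 := by field_simp
  rw [mul_add] at h1
  linarith

end Duality

/-! ### From the diamond norm to the dual constraint. -/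

section DiamondNorm

variable {a b : Type*} [Fintype a] [DecidableEq a] [Fintype b] [DecidableEq b]

/-- Any vector on `A ⊗ A` is `(T ⊗ 1)|Ω⟩` for some `T`. -/
theorem idTensor_vecMulVec (Φ : Map a b) (T : Matrix a a ℂ) :
    idTensor a Φ (Matrix.vecMulVec (fun x : a × a => T x.1 x.2)
      (star fun x : a × a => T x.1 x.2)) =
      (T ⊗ₖ (1 : Matrix b b ℂ)) * choi Φ * (T ⊗ₖ (1 : Matrix b b ℂ)).conjTranspose := by
  ext x y
  rw [idTensor_apply_eq_sum, Matrix.mul_apply]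
  simp only [Matrix.mul_apply, Matrix.conjTranspose_apply, Matrix.vecMulVec_apply, Pi.star_apply,
    Fintype.sum_prod_type, Matrix.kroneckerMap_apply, Matrix.one_apply, apply_ite (star : ℂ → ℂ),
    star_zero, ite_mul, mul_ite, zero_mul, mul_one, mul_zero, Finset.sum_ite_eq, Finset.mem_univ, if_true, Finset.sum_mul]
  rw [Finset.sum_comm]
  exact Finset.sum_congr rfl fun i _ => Finset.sum_congr rfl fun j _ => by ring

/-- For `σ = T*T` with `T` invertible, conjugating `Q` by `(T⁻¹)* ⊗ 1` gives an effect. Test the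
trace norm with it at the normalised state `(T ⊗ 1)|Ω⟩`; the output trace is `t` because `Tr_B J =
t·1`. -/
theorem re_trace_mul_choi_le [Nonempty a] {Φ : Map a b} (hΦ : (choi Φ).IsHermitian) {t D : ℝ}
    (ht : traceB (choi Φ) = t • (1 : Matrix a a ℂ)) (hD : D ∈ upperBounds (diamondSet Φ))
    {σ : Matrix a a ℂ} {Q : Matrix (a × b) (a × b) ℂ} (hσ : σ.PosDef) (hQ : Q.PosSemidef)
    (hQσ : (σ ⊗ₖ (1 : Matrix b b ℂ) - Q).PosSemidef) :
    (Q * choi Φ).trace.re ≤ (D + t) / 2 * σ.trace.re := by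
  obtain ⟨T, rfl⟩ := exists_eq_conjTranspose_mul_self hσ.posSemidef
  have hT : IsUnit T.det := by
    have h1 := (Matrix.isUnit_iff_isUnit_det _).mp hσ.isUnit
    rw [Matrix.det_mul] at h1
    exact isUnit_of_mul_isUnit_right h1
  set s : ℝ := (T.conjTranspose * T).trace.re with hs
  have hspos : 0 < s := (Complex.lt_def.mp hσ.trace_pos).1
  set ψ : a × a → ℂ := fun x => T x.1 x.2 with hψ
  set ρ : Matrix (a × a) (a × a) ℂ := Matrix.vecMulVec ψ (star ψ)
  have hρ : ρ.PosSemidef := Matrix.posSemidef_vecMulVec_self_star ψ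
  have hρtr : ρ.trace = (s : ℂ) := by
    have h1 : ρ.trace = (T.conjTranspose * T).trace := by
      rw [Matrix.trace_mul_comm]
      simp [ρ, ψ, Matrix.trace, Matrix.vecMulVec_apply, Fintype.sum_prod_type, Matrix.mul_apply]
    rw [h1]
    refine Complex.ext rfl ?_
    exact (Complex.lt_def.mp hσ.trace_pos).2.symm
  have hstate : IsState (s⁻¹ • ρ) := by
    refine ⟨posSemidef_real_smul hρ (by positivity), ?_⟩
    rw [Matrix.trace_smul, hρtr, Complex.real_smul, Complex.ofReal_inv,
      inv_mul_cancel₀ (by exact_mod_cast hspos.ne')]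
  set Z : Matrix (a × b) (a × b) ℂ := T ⊗ₖ 1
  set W : Matrix (a × b) (a × b) ℂ := (T⁻¹).conjTranspose ⊗ₖ 1
  have hWZ : W.conjTranspose * Z = 1 := by
    rw [Matrix.conjTranspose_kronecker, Matrix.conjTranspose_conjTranspose,
      Matrix.conjTranspose_one, ← Matrix.mul_kronecker_mul, Matrix.nonsing_inv_mul _ hT,
      Matrix.mul_one, Matrix.one_kronecker_one]
  have hZW : Z.conjTranspose * W = 1 := by
    have := congrArg Matrix.conjTranspose hWZ
    rwa [Matrix.conjTranspose_mul, Matrix.conjTranspose_conjTranspose,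
      Matrix.conjTranspose_one] at this
  have hσZ : (T.conjTranspose * T) ⊗ₖ (1 : Matrix b b ℂ) = Z.conjTranspose * Z := by
    rw [Matrix.conjTranspose_kronecker, ← Matrix.mul_kronecker_mul, Matrix.conjTranspose_one,
      Matrix.mul_one]
  have hZWc : Z * W.conjTranspose = 1 := mul_eq_one_comm.mp hWZ
  have hWZc : W * Z.conjTranspose = 1 := mul_eq_one_comm.mp hZW
  have hP := hQ.mul_mul_conjTranspose_same W
  have hP1 : (1 - W * Q * W.conjTranspose).PosSemidef := by
    have h1 := hQσ.mul_mul_conjTranspose_same W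
    rwa [hσZ, Matrix.mul_sub, Matrix.sub_mul, ← Matrix.mul_assoc W, hWZc, Matrix.one_mul,
      hZWc] at h1
  have hX : idTensor a Φ ρ = Z * choi Φ * Z.conjTranspose := idTensor_vecMulVec Φ T
  have hle := two_mul_re_trace_sub_le_traceNorm (isHermitian_idTensor hΦ hstate.1.1) hP hP1
  have hle2 := hle.trans (hD ⟨_, hstate, rfl⟩)
  have hsm : idTensor a Φ (s⁻¹ • ρ) = s⁻¹ • idTensor a Φ ρ :=
    (idTensor a Φ).map_smul_of_tower s⁻¹ ρ
  have htr1 : (W * Q * W.conjTranspose * idTensor a Φ ρ).trace = (Q * choi Φ).trace := by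
    rw [hX, show W * Q * W.conjTranspose * (Z * choi Φ * Z.conjTranspose) =
      W * (Q * (W.conjTranspose * Z) * choi Φ) * Z.conjTranspose by simp only [Matrix.mul_assoc],
      hWZ, Matrix.mul_one, Matrix.trace_mul_cycle, hZW, Matrix.one_mul]
  have htr2 : (idTensor a Φ ρ).trace.re = t * s := by
    rw [hX, Matrix.trace_mul_cycle, ← hσZ, trace_kronecker_one_mul, ht]
    simp [hs]
  rw [hsm, Matrix.mul_smul, Matrix.trace_smul, Matrix.trace_smul, Complex.smul_re,
    Complex.smul_re, htr1, htr2, smul_eq_mul, smul_eq_mul] at hle2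
  have h4 : s⁻¹ * (t * s) = t := by field_simp
  rw [h4] at hle2
  have h5 : s * (s⁻¹ * (Q * choi Φ).trace.re) = (Q * choi Φ).trace.re := by field_simp
  nlinarith

end DiamondNorm

end QuantumMap

end

noncomputable section

namespace QuantumMap

/-! ### Attainment of the diamond norm. -/

section Attainment

variable {a b : Type*} [Fintype a] [DecidableEq a] [Fintype b] [DecidableEq b]

omit [DecidableEq a] in
theorem isCompact_setOf_isState : IsCompact {ρ : Matrix a a ℂ | IsState ρ} := by
  have h : {ρ : Matrix a a ℂ | IsState ρ} =
      {ρ | ρ.PosSemidef ∧ ρ.trace.re ≤ 1} ∩ {ρ | ρ.trace = 1} := by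
    ext ρ
    exact ⟨fun h => ⟨⟨h.1, by rw [h.2, Complex.one_re]⟩, h.2⟩, fun h => ⟨h.1.1, h.2⟩⟩
  rw [h]
  exact (isCompact_posSemidef_trace_le 1).inter_right
    (isClosed_eq continuous_id.matrix_trace continuous_const)

theorem isCompact_setOf_effect :
    IsCompact {P : Matrix a a ℂ | P.PosSemidef ∧ (1 - P).PosSemidef} := by
  have h : {P : Matrix a a ℂ | P.PosSemidef ∧ (1 - P).PosSemidef} =
      {P | P.PosSemidef ∧ P.trace.re ≤ (Fintype.card a : ℝ)} ∩ {P | (1 - P).PosSemidef} := by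
    ext P
    refine ⟨fun h => ⟨⟨h.1, ?_⟩, h.2⟩, fun h => ⟨h.1.1, h.2⟩⟩
    have h1 := (Complex.le_def.mp h.2.trace_nonneg).1
    simpa using h1
  rw [h]
  exact (isCompact_posSemidef_trace_le _).inter_right
    (isClosed_posSemidef.preimage (by fun_prop))

theorem exists_isState [Nonempty a] : ∃ ρ : Matrix (a × a) (a × a) ℂ, IsState ρ := by
  obtain ⟨x⟩ := (inferInstance : Nonempty (a × a))
  refine ⟨Matrix.vecMulVec (Pi.single x 1) (star (Pi.single x 1)),
    Matrix.posSemidef_vecMulVec_self_star _, ?_⟩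
  rw [Matrix.trace_vecMulVec]
  simp

/-- Maximising jointly over states and effects replaces the trace norm by a visibly continuous
function on a compact set. -/
theorem exists_isGreatest_diamondSet [Nonempty a] {Φ : Map a b} (hΦ : (choi Φ).IsHermitian) :
    ∃ D, IsGreatest (diamondSet Φ) D := by
  obtain ⟨ρ₀, hρ₀⟩ := exists_isState (a := a)
  have hcomp := (isCompact_setOf_isState (a := a × a)).prod (isCompact_setOf_effect (a := a × b))
  have hcont : Continuous fun w : Matrix (a × a) (a × a) ℂ × Matrix (a × b) (a × b) ℂ =>
      2 * (w.2 * idTensor a Φ w.1).trace.re - (idTensor a Φ w.1).trace.re := by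
    have h1 : Continuous (idTensor a Φ) := by
      refine continuous_matrix fun x y => ?_
      simp only [idTensor_apply_eq_sum]
      fun_prop
    have h2 := h1.comp (continuous_fst (X := Matrix (a × a) (a × a) ℂ)
      (Y := Matrix (a × b) (a × b) ℂ))
    exact (continuous_const.mul
      (Complex.continuous_re.comp (continuous_snd.matrix_mul h2).matrix_trace)).sub
      (Complex.continuous_re.comp h2.matrix_trace)
  obtain ⟨⟨ρ, P⟩, ⟨hρ, hP⟩, hmax⟩ := hcomp.exists_isMaxOn
    ⟨(ρ₀, 0), hρ₀, .zero, by simpa using .one⟩ hcont.continuousOn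
  refine ⟨_, ⟨ρ, hρ, rfl⟩, ?_⟩
  rintro x ⟨ρ', hρ', rfl⟩
  obtain ⟨P', hP', hP1', h⟩ :=
    exists_two_mul_re_trace_sub_eq_traceNorm (isHermitian_idTensor hΦ hρ'.1.1)
  rw [← h]
  exact (hmax (show (ρ', P') ∈ _ from ⟨hρ', hP', hP1'⟩)).trans
    (two_mul_re_trace_sub_le_traceNorm (isHermitian_idTensor hΦ hρ.1.1) hP.1 hP.2)

end Attainment

/-! ### Weak duality and the optimal channel decomposition. -/

section Decomposition

variable {a b : Type*} [Fintype a] [DecidableEq a] [Fintype b] [DecidableEq b]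

theorem traceNorm_idTensor_sub_le {Λ Γ : Map a b} (hΛ : CP Λ) (hΓ : CP Γ)
    {ρ : Matrix (a × a) (a × a) ℂ} (hρ : ρ.PosSemidef) :
    traceNorm (idTensor a (Λ - Γ) ρ) ≤
      (idTensor a Λ ρ).trace.re + (idTensor a Γ ρ).trace.re := by
  rw [idTensor_sub]
  exact traceNorm_sub_le (hΛ ρ hρ) (hΓ ρ hρ)

omit [DecidableEq a] [DecidableEq b] in
theorem re_trace_smul_idTensor_le {Λ : Map a b} (h : CPTNI Λ) {r : ℝ} (hr : 0 ≤ r)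
    {ρ : Matrix (a × a) (a × a) ℂ} (hρ : IsState ρ) :
    (idTensor a (r • Λ) ρ).trace.re ≤ r := by
  rw [idTensor_smul, Matrix.trace_smul, Complex.smul_re, smul_eq_mul]
  have := h.re_trace_idTensor_le hρ.1
  rw [hρ.2, Complex.one_re] at this
  exact mul_le_of_le_one_right hr this

theorem le_of_mem_baseNormSet {Φ : Map a b} {D x : ℝ} (hD : D ∈ diamondSet Φ)
    (hx : x ∈ baseNormSet Φ) : D ≤ x := by
  obtain ⟨ρ, hρ, rfl⟩ := hD
  obtain ⟨p, m, Λ, Γ, hp, hm, hΛ, hΓ, rfl, rfl⟩ := hx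
  exact (traceNorm_idTensor_sub_le (hΛ.1.real_smul hp) (hΓ.1.real_smul hm) hρ.1).trans
    (add_le_add (re_trace_smul_idTensor_le hΛ hp hρ) (re_trace_smul_idTensor_le hΓ hm hρ))

omit [DecidableEq b] in
theorem channelDecompSet_subset_baseNormSet (Φ : Map a b) :
    channelDecompSet Φ ⊆ baseNormSet Φ := by
  rintro x ⟨p, m, Λ, Γ, hp, hm, hΛ, hΓ, h, rfl⟩
  exact ⟨p, m, Λ, Γ, hp, hm, hΛ.cptni, hΓ.cptni, choi_injective h, rfl⟩

variable [Nonempty b]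

omit [Fintype a] [DecidableEq a] in
theorem traceB_kronecker_normalized (X : Matrix a a ℂ) :
    traceB (X ⊗ₖ ((Fintype.card b : ℝ)⁻¹ • (1 : Matrix b b ℂ))) = X := by
  rw [traceB_kronecker, Matrix.trace_smul, Matrix.trace_one, Complex.real_smul]
  have : (Fintype.card b : ℂ) ≠ 0 := by exact_mod_cast Fintype.card_ne_zero
  push_cast
  rw [inv_mul_cancel₀ this, one_smul]

omit [DecidableEq a] in
theorem posSemidef_kronecker_normalized {X : Matrix a a ℂ} (hX : X.PosSemidef) :
    (X ⊗ₖ ((Fintype.card b : ℝ)⁻¹ • (1 : Matrix b b ℂ))).PosSemidef :=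
  hX.kronecker (posSemidef_real_smul .one (by positivity))

omit [DecidableEq b] [Nonempty b] in
theorem exists_cptp_choi_eq {M : Matrix (a × b) (a × b) ℂ} (hM : M.PosSemidef)
    (htr : traceB M = 1) : ∃ Λ : Map a b, CPTP Λ ∧ choi Λ = M :=
  ⟨ofChoi M, ⟨(cp_iff_posSemidef_choi _).mpr (by rwa [choi_ofChoi]),
    (tracePreserving_iff _).mpr (by rwa [choi_ofChoi])⟩, choi_ofChoi M⟩

theorem exists_cptp_smul_choi_eq [Nonempty a] {M : Matrix (a × b) (a × b) ℂ} (hM : M.PosSemidef)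
    {μ : ℝ} (htr : traceB M = μ • (1 : Matrix a a ℂ)) :
    0 ≤ μ ∧ ∃ Λ : Map a b, CPTP Λ ∧ M = μ • choi Λ := by
  have hμ : 0 ≤ μ := by
    obtain ⟨i⟩ := ‹Nonempty a›
    have h1 := re_nonneg_diag (posSemidef_traceB hM) i
    rw [htr] at h1
    simpa using h1
  refine ⟨hμ, ?_⟩
  rcases hμ.eq_or_lt with h0 | hpos
  -- If `μ = 0`, then `M` has trace zero and vanishes, so any channel serves; here the completely
  -- depolarising one.
  · obtain ⟨Λ, hΛ, -⟩ := exists_cptp_choi_eq (a := a) (b := b)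
      (posSemidef_kronecker_normalized .one) (traceB_kronecker_normalized 1)
    refine ⟨Λ, hΛ, ?_⟩
    rw [← h0, zero_smul, ← hM.trace_eq_zero_iff, ← trace_traceB, htr, ← h0, zero_smul,
      Matrix.trace_zero]
  · obtain ⟨Λ, hΛ, h⟩ := exists_cptp_choi_eq (posSemidef_real_smul hM (inv_nonneg.mpr hμ))
      (by rw [traceB_smul, htr, smul_smul, inv_mul_cancel₀ hpos.ne', one_smul])
    exact ⟨Λ, hΛ, by rw [h, smul_smul, mul_inv_cancel₀ hpos.ne', one_smul]⟩

/-- Strong duality: the diamond norm is attained by a decomposition into channels. -/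
theorem exists_channel_decomposition [Nonempty a] {Φ : Map a b} (hΦ : (choi Φ).IsHermitian)
    {t D : ℝ} (ht : traceB (choi Φ) = t • (1 : Matrix a a ℂ))
    (hD : D ∈ upperBounds (diamondSet Φ)) :
    ∃ Λ Γ : Map a b, CPTP Λ ∧ CPTP Γ ∧ 0 ≤ (D + t) / 2 ∧ 0 ≤ (D - t) / 2 ∧
      Φ = ((D + t) / 2) • Λ - ((D - t) / 2) • Γ := by
  obtain ⟨M, hM, hMJ, hMtr⟩ := exists_posSemidef_dominating hΦ ((D + t) / 2)
    fun σ Q hσ hQ hQσ => re_trace_mul_choi_le hΦ ht hD hσ hQ hQσ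
  -- `R` is the slack of the partial-trace constraint tensored with the maximally mixed state:
  -- adding it saturates the constraint and keeps both `M` and `M - J` positive.
  set R := (((D + t) / 2) • (1 : Matrix a a ℂ) - traceB M) ⊗ₖ
    ((Fintype.card b : ℝ)⁻¹ • (1 : Matrix b b ℂ)) with hR
  have hRpos : R.PosSemidef := posSemidef_kronecker_normalized hMtr
  have htr : traceB (M + R) = ((D + t) / 2) • (1 : Matrix a a ℂ) := by
    rw [traceB_add, hR, traceB_kronecker_normalized, add_sub_cancel]
  have htr' : traceB (M + R - choi Φ) = ((D - t) / 2) • (1 : Matrix a a ℂ) := by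
    rw [traceB_sub, htr, ht, ← sub_smul]
    congr 1
    ring
  obtain ⟨h1, Λ, hΛ, hΛM⟩ := exists_cptp_smul_choi_eq (hM.add hRpos) htr
  obtain ⟨h2, Γ, hΓ, hΓM⟩ := exists_cptp_smul_choi_eq
    (show (M + R - choi Φ).PosSemidef by rw [add_sub_right_comm]; exact hMJ.add hRpos) htr'
  refine ⟨Λ, Γ, hΛ, hΓ, h1, h2, choi_injective ?_⟩
  rw [choi_sub, choi_smul, choi_smul, ← hΛM, ← hΓM, sub_sub_cancel]

end Decomposition

/-! ### Lower bounds for the robustnesses. -/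

section Robustness

variable {a b : Type*} [Fintype a] [DecidableEq a] [Fintype b] [DecidableEq b] {Φ : Map a b}
  {D l : ℝ}

omit [DecidableEq a] [DecidableEq b] in
theorem robustnessSet_subset_robustnessSet'' (Φ : Map a b) :
    robustnessSet Φ ⊆ robustnessSet'' Φ := by
  rintro l ⟨hl, Λ, hΛ, h⟩
  refine ⟨hl, Λ, hΛ, ?_⟩
  have h1 := h.1.real_smul (show 0 ≤ 1 + l by linarith)
  rwa [smul_smul, mul_inv_cancel₀ (by linarith : (1 + l) ≠ 0), one_smul] at h1

omit [DecidableEq a] [DecidableEq b] in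
theorem TracePreserving.re_trace_idTensor (hΦ : TracePreserving Φ)
    {ρ : Matrix (a × a) (a × a) ℂ} (hρ : IsState ρ) : (idTensor a Φ ρ).trace.re = 1 := by
  rw [trace_idTensor, hΦ, trace_traceA, hρ.2, Complex.one_re]

/-- Write `Φ = (Φ + lΛ) - lΛ`: on a state the two output traces are at most `1 + l` and `l`. -/
theorem le_of_mem_robustnessSet'' (hΦ : TracePreserving Φ) (hD : D ∈ diamondSet Φ)
    (hl : l ∈ robustnessSet'' Φ) : (D - 1) / 2 ≤ l := by
  obtain ⟨ρ, hρ, rfl⟩ := hD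
  obtain ⟨hl, Λ, hΛ, h⟩ := hl
  have h1 := traceNorm_idTensor_sub_le h (hΛ.1.real_smul hl) hρ.1
  rw [add_sub_cancel_right, idTensor_add, Matrix.trace_add, Complex.add_re,
    hΦ.re_trace_idTensor hρ] at h1
  linarith [re_trace_smul_idTensor_le hΛ hl hρ]

/-- Write `Φ = (1+l)Λ - ((1+l)Λ - Φ)`: on a state the output traces are at most `1 + l` and `l`. -/
theorem le_of_mem_robustnessSet' (hΦ : TracePreserving Φ) (hD : D ∈ diamondSet Φ)
    (hl : l ∈ robustnessSet' Φ) : (D - 1) / 2 ≤ l := by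
  obtain ⟨ρ, hρ, rfl⟩ := hD
  obtain ⟨hl, Λ, hΛ, h⟩ := hl
  have hl1 : 0 ≤ 1 + l := by linarith
  have h2 : CP ((1 + l) • Λ - Φ) := (cp_iff_posSemidef_choi _).mpr h
  have h1 := traceNorm_idTensor_sub_le (hΛ.1.real_smul hl1) h2 hρ.1
  rw [sub_sub_cancel, idTensor_sub, Matrix.trace_sub, Complex.sub_re,
    hΦ.re_trace_idTensor hρ] at h1
  linarith [re_trace_smul_idTensor_le hΛ hl1 hρ]

end Robustness

end QuantumMap

end

/-! ### The main theorem. -/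

theorem theorem1 {a b : Type*} [Fintype a] [DecidableEq a] [Nonempty a]
    [Fintype b] [DecidableEq b] [Nonempty b]
    (Φ : QuantumMap.Map a b) (hΦ : QuantumMap.HermitianPreserving Φ) :
    ((∃ t : ℂ, QuantumMap.traceB (QuantumMap.choi Φ) = t • (1 : Matrix a a ℂ)) →
      IsGreatest (QuantumMap.diamondSet Φ) (QuantumMap.diamondNorm Φ) ∧
      IsLeast (QuantumMap.baseNormSet Φ) (QuantumMap.baseNorm Φ) ∧
      QuantumMap.diamondNorm Φ = QuantumMap.baseNorm Φ ∧
      IsLeast (QuantumMap.channelDecompSet Φ) (QuantumMap.diamondNorm Φ)) ∧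
    (QuantumMap.TracePreserving Φ →
      IsLeast (QuantumMap.robustnessSet Φ) (QuantumMap.robustness Φ) ∧
      IsLeast (QuantumMap.robustnessSet' Φ) (QuantumMap.robustness' Φ) ∧
      IsLeast (QuantumMap.robustnessSet'' Φ) (QuantumMap.robustness'' Φ) ∧
      QuantumMap.robustness Φ = QuantumMap.robustness' Φ ∧
      QuantumMap.robustness' Φ = QuantumMap.robustness'' Φ ∧
      QuantumMap.robustness'' Φ = (QuantumMap.baseNorm Φ - 1) / 2 ∧
      (QuantumMap.baseNorm Φ - 1) / 2 = (QuantumMap.diamondNorm Φ - 1) / 2) := by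
  open QuantumMap in
  have hJ := isHermitian_choi hΦ
  obtain ⟨D, hD⟩ := exists_isGreatest_diamondSet hJ
  have hdiamond : diamondNorm Φ = D := hD.csSup_eq
  have hbase {t : ℝ} (ht : traceB (choi Φ) = t • (1 : Matrix a a ℂ)) :
      IsLeast (channelDecompSet Φ) D ∧ IsLeast (baseNormSet Φ) D := by
    obtain ⟨Λ, Γ, hΛ, hΓ, h1, h2, h⟩ := exists_channel_decomposition hJ ht hD.2
    have hmem : D ∈ channelDecompSet Φ :=
      ⟨_, _, Λ, Γ, h1, h2, hΛ, hΓ, congrArg choi h, by ring⟩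
    exact ⟨⟨hmem, fun x hx =>
        le_of_mem_baseNormSet hD.1 (channelDecompSet_subset_baseNormSet Φ hx)⟩,
      channelDecompSet_subset_baseNormSet Φ hmem, fun x hx => le_of_mem_baseNormSet hD.1 hx⟩
  constructor
  · rintro ⟨t, ht⟩
    -- The scalar `t` is a diagonal entry of the partial trace of a Hermitian operator, hence real.
    have htre : t = (t.re : ℂ) := by
      obtain ⟨i⟩ := ‹Nonempty a›
      have h1 : star (traceB (choi Φ) i i) = traceB (choi Φ) i i := by
        simp only [traceB, Matrix.of_apply, star_sum]
        exact Finset.sum_congr rfl fun p _ => hJ.apply _ _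
      rw [ht] at h1
      simp only [Matrix.smul_apply, Matrix.one_apply_eq, smul_eq_mul, mul_one] at h1
      exact (Complex.conj_eq_iff_re.mp h1).symm
    have ht' : traceB (choi Φ) = t.re • (1 : Matrix a a ℂ) := by
      rw [ht, htre, Complex.ofReal_re]
      rfl
    obtain ⟨hc, hb⟩ := hbase ht'
    have hbn : baseNorm Φ = D := hb.csInf_eq
    rw [hdiamond, hbn]
    exact ⟨hD, hb, rfl, hc⟩
  · intro hTP
    have ht : traceB (choi Φ) = (1 : ℝ) • (1 : Matrix a a ℂ) := by
      rw [one_smul]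
      exact (tracePreserving_iff Φ).mp hTP
    have hbn : baseNorm Φ = D := (hbase ht).2.csInf_eq
    obtain ⟨Λ, Γ, hΛ, hΓ, h1, h2, h⟩ := exists_channel_decomposition hJ ht hD.2
    have hr : (D + 1) / 2 = 1 + (D - 1) / 2 := by ring
    rw [hr] at h h1
    -- This identity makes `Γ` the noise map for `R` and `R''`, and `Λ` the dominating channel for
    -- `R'`.
    have hsum : Φ + ((D - 1) / 2) • Γ = (1 + (D - 1) / 2) • Λ := by
      rw [sub_eq_iff_eq_add.mp h.symm]
    have hmem : (D - 1) / 2 ∈ robustnessSet Φ := by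
      refine ⟨h2, Γ, hΓ.cptni, ?_⟩
      rw [hsum, smul_smul, inv_mul_cancel₀ (by linarith : (1 + (D - 1) / 2) ≠ 0), one_smul]
      exact hΛ.cptni
    have hmem' : (D - 1) / 2 ∈ robustnessSet' Φ := by
      refine ⟨h2, Λ, hΛ.cptni, ?_⟩
      rw [← choi_smul, ← hsum, choi_add, add_sub_cancel_left, choi_smul]
      exact posSemidef_real_smul ((cp_iff_posSemidef_choi Γ).mp hΓ.1) h2
    have hR : IsLeast (robustnessSet Φ) ((D - 1) / 2) := ⟨hmem, fun l hl =>
      le_of_mem_robustnessSet'' hTP hD.1 (robustnessSet_subset_robustnessSet'' Φ hl)⟩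
    have hR' : IsLeast (robustnessSet' Φ) ((D - 1) / 2) :=
      ⟨hmem', fun l hl => le_of_mem_robustnessSet' hTP hD.1 hl⟩
    have hR'' : IsLeast (robustnessSet'' Φ) ((D - 1) / 2) :=
      ⟨robustnessSet_subset_robustnessSet'' Φ hmem,
        fun l hl => le_of_mem_robustnessSet'' hTP hD.1 hl⟩
    have e : robustness Φ = (D - 1) / 2 := hR.csInf_eq
    have e' : robustness' Φ = (D - 1) / 2 := hR'.csInf_eq
    have e'' : robustness'' Φ = (D - 1) / 2 := hR''.csInf_eq
    rw [e, e', e'', hbn, hdiamond]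
    exact ⟨hR, hR', hR'', rfl, rfl, rfl, rfl⟩
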